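/- **Setting.** A Bratteli diagram $B$ has finite vertex sets $V_n$ ($n\ge 0$, $V_0=\{v_0\}$) and finite edge sets $E_n$ ($n\ge1$) with surjective source and range maps $s:E_n\to V_{n-1}$, $r:E_n\to V_n$. $X_B$ is the space of infinite paths from $v_0$ with the topology generated by the cylinder sets, and $F_n=(f^{(n)}_{u,w})_{u\in V_{n+1},w\in V_n}$ is the $n$-th incidence matrix, $f^{(n)}_{u,w}=|\{e\in E_{n+1}: r(e)=u,\ s(e)=w\}|$. $B$ is *simple* if for each $n$ there is $m>n$ such that every vertex of $V_n$ is joined by a path to every vertex of $V_m$. $B$ has *strict rank $d$* if $V_n=V$ for all $n\ge1$ with $|V|=d$, and $|r^{-1}(v)|\ge2$ for every vertex $v\ne v_0$. An *ordering* $\omega$ is a choice of a linear order on each $r^{-1}(v)$, $v\neq v_0$. A path is maximal (minimal) if all its edges $e$ are maximal (minimal) in $r^{-1}(r(e))$; $X_{\max}(\omega)$, $X_{\min}(\omega)$ are the sets of such paths in $X_B$. A *Vershik map* of $\omega$ is a homeomorphism $\varphi$ of $X_B$ with $\varphi(X_{\max}(\omega))=X_{\min}(\omega)$ such that for $x\notin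 X_{\max}(\omega)$, $\varphi(x)=(x^0_1,\dots,x^0_{k-1},\overline{x_k},x_{k+1},\dots)$, where $k$ is the least index with $x_k$ not maximal, $\overline{x_k}$ is the successor of $x_k$ in $r^{-1}(r(x_k))$ and $(x_1^0,\dots,x_{k-1}^0)$ is the minimal path from $v_0$ to $s(\overline{x_k})$. The ordering $\omega$ is *perfect* if it has a Vershik map. A *skeleton* $\mathcal F$ on a strict rank $d$ diagram $B$ consists of subsets $\widetilde V,\overline V\subseteq V$ of equal cardinality, infinite paths $M_{\tilde v}$ ($\tilde v\in\widetilde V$) and $m_{\bar v}$ ($\bar v\in\overline V$) in $X_B$ passing at every level $n\ge 1$ through $\tilde v$, respectively $\bar v$, and for each $n\ge1$ and each $w\in V_n$ two distinct edges $\tilde e_w,\bar e_w\in E_n$ with range $w$, such that: for $n\ge2$, $s(\tilde e_w)\in\widetilde V$ and $s(\bar e_w)\in\overline V$, and these two vertices depend only on $w$ as an element of $V$, not on $n$; for all $n\ge 1$, $\tilde e_w=M_w(n)$ if $w\in\widetilde V$ and $\bar e_w=m_w(n)$ if $w\in\overline V$. We say that $\mathcal F$ is the skeleton of $\omega$, $\mathcal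 F=\mathcal F_\omega$, if each $\tilde e_w$ is maximal and each $\bar e_w$ is minimal for $\omega$, $X_{\max}(\omega)=\{M_{\tilde v}:\tilde v\in\widetilde V\}$ and $X_{\min}(\omega)=\{m_{\bar v}:\bar v\in\overline V\}$. For $w\in V$ let $s(\tilde e_w)$, $s(\bar e_w)$ denote these level-independent sources. Put $W_{\tilde v}=\{w\in V:s(\tilde e_w)=\tilde v\}$, $W'_{\bar v}=\{w\in V:s(\bar e_w)=\bar v\}$ and $[\bar v,\tilde v]=W'_{\bar v}\cap W_{\tilde v}$. For $n\ge1$, $u\in V_{n+1}$, $w\in V_n$ let $\tilde f^{(n)}_{u,w}=f^{(n)}_{u,w}-1$ if $s(\tilde e_u)=w$ and $\tilde f^{(n)}_{u,w}=f^{(n)}_{u,w}$ otherwise; define $\bar f^{(n)}_{u,w}$ in the same way with $\bar e_u$ instead of $\tilde e_u$. Let $\sigma:\widetilde V\to\overline V$ be a bijection. The associated graph $\mathcal H_n$ is the directed graph whose vertices are the pairs $(\bar v,\tilde v)\in\overline V\times\widetilde V$ with $[\bar v,\tilde v]\ne\emptyset$, with an edge from $(\bar v,\tilde v)$ to $(\bar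 v_1,\tilde v_1)$ if and only if $\sigma(\tilde v)=\bar v_1$. It is *positively strongly connected* if for each $u\in V_{n+1}$ the subgraph induced on the vertices $(\bar v,\tilde v)$ with $\sum_{w\in[\bar v,\tilde v]}\tilde f^{(n)}_{u,w}>0$ is strongly connected (a one-vertex graph counts as strongly connected). $F_n$ satisfies the *balance relations* if $$\sum_{w\in W_{\tilde v}}\tilde f^{(n)}_{u,w}=\sum_{w'\in W'_{\sigma(\tilde v)}}\bar f^{(n)}_{u,w'}\qquad\text{for all }u\in V_{n+1},\ \tilde v\in\widetilde V.$$ **Theorem.** Let $B$ be a simple strict rank $d$ Bratteli diagram, let $\mathcal F$ be a skeleton on $B$ and let $\sigma:\widetilde V\to\overline V$ be a bijection. Suppose that for all sufficiently large $n$ the graph $\mathcal H_n$ is positively strongly connected, and that for all sufficiently large $n$ the incidence matrix $F_n$ satisfies the balance relations. Then there is a perfect ordering $\omega$ on $B$ such that $\mathcal F=\mathcal F_\omega$ and the Vershik map $\varphi_\omega$ satisfies $\varphi_\omega(M_{\tilde v})=m_{\sigma(\tilde v)}$ for all $\tilde v\in\widetilde V$. -/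

import Mathlib

/-- A Bratteli diagram. `Vert n` is the vertex set of level `n`, and `Edge n` is the set of edges
from level `n` to level `n + 1` (the set usually written as the edge set of index `n + 1`). -/
structure BratteliDiagram where
  Vert : ℕ → Type*
  Edge : ℕ → Type*
  src : ∀ {n : ℕ}, Edge n → Vert n
  rng : ∀ {n : ℕ}, Edge n → Vert (n + 1)
  unique_top : Nonempty (Unique (Vert 0))
  finite_vert : ∀ n, Finite (Vert n)
  finite_edge : ∀ n, Finite (Edge n)
  src_surjective : ∀ n, Function.Surjective (src : Edge n → Vert n)
  rng_surjective : ∀ n, Function.Surjective (rng : Edge n → Vert (n + 1))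

namespace BratteliDiagram

/-- `B.HasPath v w`: there is a finite (downward) path from the vertex `v` to the vertex `w`. -/
inductive HasPath (B : BratteliDiagram) {n : ℕ} (v : B.Vert n) : ∀ {m : ℕ}, B.Vert m → Prop
  | nil : HasPath B v v
  | cons {m : ℕ} (e : B.Edge m) : HasPath B v (B.src e) → HasPath B v (B.rng e)

/-- Simple diagrams: for each level `n` there is a level `m > n` such that every vertex of
level `n` is joined by a path to every vertex of level `m`. -/
def IsSimple (B : BratteliDiagram) : Prop :=
  ∀ n, ∃ m, n < m ∧ ∀ (v : B.Vert n) (w : B.Vert m), B.HasPath v w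

/-- The `n`-th incidence matrix: the number of edges from `w` in level `n` to `v` in
level `n + 1`. -/
noncomputable def incidence (B : BratteliDiagram) (n : ℕ) :
    Matrix (B.Vert (n + 1)) (B.Vert n) ℕ :=
  fun v w => Nat.card {e : B.Edge n // B.rng e = v ∧ B.src e = w}

/-- The space of infinite paths starting at the top vertex. -/
def PathSpace (B : BratteliDiagram) : Type _ :=
  {x : ∀ n, B.Edge n // ∀ n, B.rng (x n) = B.src (x (n + 1))}

/-- The topology generated by the cylinder sets: it is induced by the product of the discrete
topologies on the edge sets. -/
instance (B : BratteliDiagram) : TopologicalSpace B.PathSpace :=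
  TopologicalSpace.induced Subtype.val (@Pi.topologicalSpace ℕ B.Edge fun _ => ⊥)

/-- An ordering on a Bratteli diagram: a (strict) partial order on the edges which restricts to a
linear order on each set of edges with a given range, edges with different ranges being
incomparable. -/
structure EdgeOrdering (B : BratteliDiagram) where
  lt : ∀ {n : ℕ}, B.Edge n → B.Edge n → Prop
  rng_eq_of_lt : ∀ {n : ℕ} {e f : B.Edge n}, lt e f → B.rng e = B.rng f
  irrefl : ∀ {n : ℕ} (e : B.Edge n), ¬ lt e e
  trans : ∀ {n : ℕ} {e f g : B.Edge n}, lt e f → lt f g → lt e g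
  total : ∀ {n : ℕ} {e f : B.Edge n}, B.rng e = B.rng f → e ≠ f → lt e f ∨ lt f e

namespace EdgeOrdering

variable {B : BratteliDiagram} (ω : B.EdgeOrdering)

/-- `e` is maximal among the edges with the same range. -/
def IsMaxEdge {n : ℕ} (e : B.Edge n) : Prop := ∀ f : B.Edge n, ¬ ω.lt e f

/-- `e` is minimal among the edges with the same range. -/
def IsMinEdge {n : ℕ} (e : B.Edge n) : Prop := ∀ f : B.Edge n, ¬ ω.lt f e

/-- `f` is the successor of `e` among the edges with the same range. -/
def IsSuccessor {n : ℕ} (e f : B.Edge n) : Prop :=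
  ω.lt e f ∧ ∀ g : B.Edge n, ¬ (ω.lt e g ∧ ω.lt g f)

/-- The set of maximal infinite paths. -/
def maxPaths : Set B.PathSpace := {x | ∀ n, ω.IsMaxEdge (x.1 n)}

/-- The set of minimal infinite paths. -/
def minPaths : Set B.PathSpace := {x | ∀ n, ω.IsMinEdge (x.1 n)}

/-- `φ` is a (continuous) Vershik map of the ordered diagram: a homeomorphism of the path space
which maps the maximal paths onto the minimal paths, and which, on a path whose first
non-maximal edge has index `k`, replaces this edge by its successor, the edges before it by
minimal edges, and keeps the later edges. -/
structure IsVershikMap (φ : B.PathSpace ≃ₜ B.PathSpace) : Prop where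
  image_maxPaths : φ '' ω.maxPaths = ω.minPaths
  apply_of_not_max : ∀ (x : B.PathSpace) (k : ℕ),
    (∀ i < k, ω.IsMaxEdge (x.1 i)) → ¬ ω.IsMaxEdge (x.1 k) →
      (∀ i < k, ω.IsMinEdge ((φ x).1 i)) ∧
      ω.IsSuccessor (x.1 k) ((φ x).1 k) ∧
      ∀ i > k, (φ x).1 i = x.1 i

/-- An ordering is perfect if it admits a Vershik map. -/
def IsPerfect : Prop := ∃ φ : B.PathSpace ≃ₜ B.PathSpace, ω.IsVershikMap φ

end EdgeOrdering

/-- `B` is strictly of rank `d`: all levels `n ≥ 1` have the same vertex set `V` with `d`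
elements (the bijection `label n` identifies level `n + 1` with `V`), and each vertex outside
level `0` is the range of at least two edges. -/
structure StrictRank (B : BratteliDiagram) (V : Type*) [Fintype V] (d : ℕ) where
  label : ∀ n, B.Vert (n + 1) ≃ V
  card_eq : Fintype.card V = d
  two_le_card : ∀ (n : ℕ) (v : B.Vert (n + 1)), 2 ≤ Nat.card {e : B.Edge n // B.rng e = v}

/-- The entry of the incidence matrix between level `n = m + 1` and level `n + 1 = m + 2`, the
vertices of level `n` being written as elements of `V`. -/
noncomputable def StrictRank.entry {B : BratteliDiagram} {V : Type*} [Fintype V] {d : ℕ}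
    (S : B.StrictRank V d) (m : ℕ) (u : B.Vert (m + 2)) (w : V) : ℕ :=
  B.incidence (m + 1) u ((S.label m).symm w)

/-- A skeleton on a strict rank `d` diagram: sets `maxV`, `minV` of maximal and minimal vertices
of the same cardinality, vertical paths through them, and for each vertex `w` outside level `0`
two distinct edges with range `w`. Below level `1`, the sources of these two edges are a maximal
and a minimal vertex which depend only on the label of `w`, not on the level. At maximal
(minimal) vertices the selected edges are the edges of the vertical paths; so the two vertical
paths through a vertex which is both maximal and minimal have no common edge. -/
structure Skeleton {B : BratteliDiagram} {V : Type*} [Fintype V] {d : ℕ}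
    (S : B.StrictRank V d) where
  maxV : Finset V
  minV : Finset V
  card_maxV_eq : maxV.card = minV.card
  maxPath : maxV → B.PathSpace
  minPath : minV → B.PathSpace
  maxPath_vertical : ∀ (v : maxV) (n : ℕ), S.label n (B.rng ((maxPath v).1 n)) = v
  minPath_vertical : ∀ (v : minV) (n : ℕ), S.label n (B.rng ((minPath v).1 n)) = v
  maxSrc : V → maxV
  minSrc : V → minV
  maxEdge : ∀ n, B.Vert (n + 1) → B.Edge n
  minEdge : ∀ n, B.Vert (n + 1) → B.Edge n
  rng_maxEdge : ∀ (n : ℕ) (w : B.Vert (n + 1)), B.rng (maxEdge n w) = w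
  rng_minEdge : ∀ (n : ℕ) (w : B.Vert (n + 1)), B.rng (minEdge n w) = w
  maxEdge_ne_minEdge : ∀ (n : ℕ) (w : B.Vert (n + 1)), maxEdge n w ≠ minEdge n w
  src_maxEdge : ∀ (n : ℕ) (w : B.Vert (n + 2)),
    S.label n (B.src (maxEdge (n + 1) w)) = maxSrc (S.label (n + 1) w)
  src_minEdge : ∀ (n : ℕ) (w : B.Vert (n + 2)),
    S.label n (B.src (minEdge (n + 1) w)) = minSrc (S.label (n + 1) w)
  maxEdge_eq : ∀ (v : maxV) (n : ℕ), maxEdge n ((S.label n).symm v) = (maxPath v).1 n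
  minEdge_eq : ∀ (v : minV) (n : ℕ), minEdge n ((S.label n).symm v) = (minPath v).1 n

namespace Skeleton

variable {B : BratteliDiagram} {V : Type*} [Fintype V] [DecidableEq V] {d : ℕ}
  {S : B.StrictRank V d} (F : Skeleton S)

/-- `F` is the skeleton of the ordering `ω`: the selected edges are the maximal and minimal edges
of `ω`, and the vertical paths of `F` are exactly the maximal and minimal paths of `ω`. -/
structure IsSkeletonOf (ω : B.EdgeOrdering) : Prop where
  isMaxEdge : ∀ (n : ℕ) (w : B.Vert (n + 1)), ω.IsMaxEdge (F.maxEdge n w)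
  isMinEdge : ∀ (n : ℕ) (w : B.Vert (n + 1)), ω.IsMinEdge (F.minEdge n w)
  maxPaths_eq : ω.maxPaths = Set.range F.maxPath
  minPaths_eq : ω.minPaths = Set.range F.minPath

/-- The set of all `w` whose selected maximal edge starts in the maximal vertex `t`. -/
def maxClass (t : F.maxV) : Finset V := Finset.univ.filter fun w => F.maxSrc w = t

/-- The set of all `w` whose selected minimal edge starts in the minimal vertex `b`. -/
def minClass (b : F.minV) : Finset V := Finset.univ.filter fun w => F.minSrc w = b

/-- The intersection `[b, t]` of the two classes. -/
def cell (b : F.minV) (t : F.maxV) : Finset V := F.minClass b ∩ F.maxClass t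

/-- The vertices of the associated graph: the pairs `(b, t)` with `[b, t]` non-empty. -/
def GraphVertex : Type _ := {p : F.minV × F.maxV // (F.cell p.1 p.2).Nonempty}

/-- The graph associated to the diagram, the skeleton and `σ`: there is an edge from `[b, t]` to
`[b', t']` if and only if `σ t = b'`. (The graphs of all levels are copies of this one.) -/
def graph (σ : F.maxV ≃ F.minV) : Digraph F.GraphVertex where
  Adj p q := σ p.1.2 = q.1.1

/-- The entry reduced by `1` if the selected maximal edge of `u` starts in `w` (the entry is then
at least `1`). -/
noncomputable def maxEntry (m : ℕ) (u : B.Vert (m + 2)) (w : V) : ℕ :=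
  if S.label m (B.src (F.maxEdge (m + 1) u)) = w then S.entry m u w - 1 else S.entry m u w

/-- The entry reduced by `1` if the selected minimal edge of `u` starts in `w` (the entry is then
at least `1`). -/
noncomputable def minEntry (m : ℕ) (u : B.Vert (m + 2)) (w : V) : ℕ :=
  if S.label m (B.src (F.minEdge (m + 1) u)) = w then S.entry m u w - 1 else S.entry m u w

/-- The balance relations for the incidence matrix between level `m + 1` and level `m + 2`. -/
def BalanceRelations (σ : F.maxV ≃ F.minV) (m : ℕ) : Prop :=
  ∀ (u : B.Vert (m + 2)) (t : F.maxV),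
    ∑ w ∈ F.maxClass t, F.maxEntry m u w = ∑ w ∈ F.minClass (σ t), F.minEntry m u w

/-- The crossing number, with respect to `u` in level `m + 2`, of the vertex `p` of the
associated graph at level `m + 1`. -/
noncomputable def crossingNumber (m : ℕ) (u : B.Vert (m + 2)) (p : F.GraphVertex) : ℕ :=
  ∑ w ∈ F.cell p.1.1 p.1.2, F.maxEntry m u w

/-- The associated graph at level `m + 1` is positively strongly connected: for each `u` in
level `m + 2`, the subgraph induced on the vertices with positive crossing number is strongly
connected. -/
def PositivelyStronglyConnected (σ : F.maxV ≃ F.minV) (m : ℕ) : Prop :=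
  ∀ (u : B.Vert (m + 2)) (p q : {p : F.GraphVertex // 0 < F.crossingNumber m u p}),
    Relation.ReflTransGen
      (fun a b : {p : F.GraphVertex // 0 < F.crossingNumber m u p} => (F.graph σ).Adj a.1 b.1) p q

end Skeleton

end BratteliDiagram

/-!
The ordering is found vertex by vertex. Regard an edge `e` with range `u` as an arc of a directed
multigraph on the minimal vertices, with tail `minSrc (src e)` and head `σ (maxSrc (src e))`.
A linear order of the edges with range `u` in which each head equals the tail of the next arc is an
Eulerian trail; it has to start with the selected minimal edge and to end with the selected maximal
edge. The balance relations say that in-degrees and out-degrees agree when the last arc is not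
counted as incoming and the first one not as outgoing, and positive strong connectedness makes the
multigraph connected, so the trail exists (`EulerianOrder.exists_index`). Euler's theorem itself is
proved for permutations of the arcs that send each arc to one starting at its head: if the cycle of
a given arc is as long as possible among these permutations, it contains all arcs, since otherwise
two cycles could be joined at a common vertex. The finitely many levels without hypotheses are
ordered arbitrarily between the selected minimal and maximal edges.

For such an ordering, a path whose edges of index at most `k` are maximal follows, below index `k`,
the vertical maximal path determined by the vertex which it reaches
(`BratteliDiagram.Skeleton.IsAdapted.apply_eq_maxPath`), and likewise for minimal edges. Hence the
infinite maximal paths are the given ones. If `x` is close to `M_t` and not maximal, its first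
non-maximal edge has a large index, and the Eulerian condition forces the successor of `x` to follow
`m_{σ t}` for a long time. So the map that sends `M_t` to `m_{σ t}` and every other path to its
successor is continuous. Its inverse is the map of the same kind for the opposite ordering, the
opposite skeleton and `σ⁻¹`, so it is a homeomorphism. Any other Vershik map agrees with it on
non-maximal paths, which accumulate at each `M_t` because the diagram is simple
(`BratteliDiagram.Skeleton.IsAdapted.exists_notMem_maxPaths`); so the two maps agree at `M_t`.
-/

/-! ### Eulerian circuits as cyclic permutations -/

namespace EulerianOrder

open Equiv Equiv.Perm

variable {α β : Type*}

theorem swap_mul_apply_of_ne [DecidableEq α] (π : Perm α) {a b y : α} (ha : y ≠ a) (hb : y ≠ b) :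
    (swap (π a) (π b) * π) y = π y := by
  rw [Perm.mul_apply, swap_apply_of_ne_of_ne]
  · exact fun h => ha (π.injective h)
  · exact fun h => hb (π.injective h)

/-- After the successors of `a` and `b`, which lie in different cycles, have been exchanged, the old
successor of `a` still leads to `a`, along the old cycle of `a`. -/
theorem sameCycle_swap_mul_self [Finite α] [DecidableEq α] (π : Perm α) {a b : α}
    (hab : ¬ π.SameCycle a b) : (swap (π a) (π b) * π).SameCycle (π a) a := by
  by_contra hcon
  have key : ∀ j : ℕ, (swap (π a) (π b) * π).SameCycle (π a) ((π ^ j) (π a)) := by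
    intro j
    induction j with
    | zero => exact SameCycle.refl _ _
    | succ j ih =>
      have hya : (π ^ j) (π a) ≠ a := fun h => hcon (by rwa [h] at ih)
      have hyb : (π ^ j) (π a) ≠ b := fun h => hab ⟨(j + 1 : ℕ), by
        rw [zpow_natCast, pow_succ, Perm.mul_apply, h]⟩
      rw [pow_succ', Perm.mul_apply, ← swap_mul_apply_of_ne π hya hyb]
      exact sameCycle_apply_right.2 ih
  obtain ⟨i, hi⟩ := (sameCycle_apply_left.2 (SameCycle.refl π a)).exists_nat_pow_eq
  exact hcon (by simpa [hi] using key i)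

/-- Exchanging the images of two points of different cycles joins these cycles; this lemma and the
next one give the part of this statement which concerns the cycle of `a`. -/
theorem SameCycle.swap_mul [Finite α] [DecidableEq α] (π : Perm α) {a b x : α}
    (hab : ¬ π.SameCycle a b) (hx : π.SameCycle a x) :
    (swap (π a) (π b) * π).SameCycle a x := by
  obtain ⟨i, rfl⟩ := hx.exists_nat_pow_eq
  clear hx
  induction i with
  | zero => exact SameCycle.refl _ _
  | succ i ih =>
    rw [pow_succ', Perm.mul_apply]
    by_cases hya : (π ^ i) a = a
    · rw [hya]
      exact (sameCycle_swap_mul_self π hab).symm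
    · have hyb : (π ^ i) a ≠ b := fun h => hab ⟨i, by rwa [zpow_natCast]⟩
      rw [← swap_mul_apply_of_ne π hya hyb]
      exact sameCycle_apply_right.2 ih

theorem sameCycle_swap_mul [Finite α] [DecidableEq α] (π : Perm α) {a b : α}
    (hab : ¬ π.SameCycle a b) : (swap (π a) (π b) * π).SameCycle a b := by
  have h := sameCycle_swap_mul_self π (a := b) (b := a) fun h => hab h.symm
  rw [swap_comm] at h
  refine SameCycle.trans ?_ h
  exact ⟨1, by simp⟩

/-- Euler's theorem on directed multigraphs. The elements of `α` are arcs with head `h` and tail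
`t`; an Eulerian circuit is a permutation of the arcs which consists of a single cycle and maps
each arc to one starting where the given arc ends. Connectedness is required in the form that a set
of arcs containing `a₀` is everything if with an arc it contains all arcs starting, and all arcs
ending, where this arc ends. -/
theorem exists_perm_sameCycle [Finite α] (h t : α → β) (a₀ : α)
    (hcard : ∀ x, Nat.card {a // h a = x} = Nat.card {a // t a = x})
    (hconn : ∀ C : Set α, a₀ ∈ C → (∀ e ∈ C, ∀ f, h e = t f ∨ h e = h f → f ∈ C) → ∀ e, e ∈ C) :
    ∃ π : Perm α, (∀ e, t (π e) = h e) ∧ ∀ e, π.SameCycle a₀ e := by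
  classical
  have hne : ∃ π : Perm α, ∀ e, t (π e) = h e := by
    exact ⟨Equiv.ofFiberEquiv fun x => (Finite.card_eq.1 (hcard x)).some,
      fun e => Equiv.ofFiberEquiv_map _ e⟩
  -- Among the permutations which respect heads and tails, one for which the cycle of `a₀` is as
  -- large as possible.
  obtain ⟨π, hπ, hmax⟩ := Set.exists_max_image {π : Perm α | ∀ e, t (π e) = h e}
    (fun π => Set.ncard {e | π.SameCycle a₀ e}) (Set.toFinite _) hne
  refine ⟨π, hπ, fun e => hconn {e | π.SameCycle a₀ e} (SameCycle.refl _ _) ?_ e⟩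
  intro e he
  have key : ∀ f, h e = h f → π.SameCycle a₀ f := by
    intro f hef
    by_contra hf
    -- As `e` and `f` have the same head, their successors can be exchanged, which would enlarge the
    -- cycle of `a₀`.
    have hef' : ¬ π.SameCycle e f := fun h => hf (he.trans h)
    have hπ' : ∀ x, t ((swap (π e) (π f) * π) x) = h x := by
      intro x
      by_cases hxe : x = e
      · rw [hxe, Perm.mul_apply, swap_apply_left, hπ f, hef]
      by_cases hxf : x = f
      · rw [hxf, Perm.mul_apply, swap_apply_right, hπ e, hef]
      rw [swap_mul_apply_of_ne π hxe hxf, hπ]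
    have hlt := hmax _ hπ'
    refine absurd hlt (not_le.2 (Set.ncard_lt_ncard ⟨fun x hx => ?_, fun hsub => hf ?_⟩))
    · exact (SameCycle.swap_mul π hef' he.symm).symm.trans
        (SameCycle.swap_mul π hef' (he.symm.trans hx))
    · exact hsub ((SameCycle.swap_mul π hef' he.symm).symm.trans (sameCycle_swap_mul π hef'))
  rintro f (hf | hf)
  · -- The predecessor of `f` has the same head as `e`.
    have := key (π.symm f) (by rw [hf, ← hπ, Equiv.apply_symm_apply])
    exact sameCycle_symm_apply_right.1 this
  · exact key f hf

/-- An Eulerian trail with prescribed first arc `a` and last arc `z`, encoded by the positions of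
the arcs on the trail. In the balance condition the last arc does not count as incoming and the
first arc does not count as outgoing. -/
theorem exists_index [Finite α] (h t : α → β) {a z : α} (haz : a ≠ z)
    (hcard : ∀ x, Nat.card {e // e ≠ z ∧ h e = x} = Nat.card {e // e ≠ a ∧ t e = x})
    (hconn : ∀ C : Set α, a ∈ C →
      (∀ e ∈ C, e ≠ z → ∀ f, f ≠ z → h e = t f ∨ h e = h f → f ∈ C) → ∀ e, e ≠ z → e ∈ C) :
    ∃ idx : α → ℕ, Function.Injective idx ∧ (∀ e, idx a ≤ idx e) ∧ (∀ e, idx e ≤ idx z) ∧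
      ∀ e f, idx e < idx f → (∀ g, ¬ (idx e < idx g ∧ idx g < idx f)) → h e = t f := by
  classical
  -- An additional vertex `none`, in which `z` ends and `a` starts, turns the trail into a circuit
  -- on which `z` is followed by `a`.
  set h' : α → Option β := fun e => if e = z then none else some (h e) with hh'
  set t' : α → Option β := fun e => if e = a then none else some (t e) with ht'
  have hz : ∀ e, h' e = none ↔ e = z := by intro e; simp [hh']
  have ha : ∀ e, t' e = none ↔ e = a := by intro e; simp [ht']
  have hsome : ∀ e x, h' e = some x ↔ e ≠ z ∧ h e = x := by
    intro e x; by_cases he : e = z <;> simp [hh', he]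
  have tsome : ∀ e x, t' e = some x ↔ e ≠ a ∧ t e = x := by
    intro e x; by_cases he : e = a <;> simp [ht', he]
  have hcard' : ∀ x, Nat.card {e // h' e = x} = Nat.card {e // t' e = x} := by
    rintro (_ | x)
    · simp only [hz, ha, Nat.card_unique]
    · simp only [hsome, tsome, hcard]
  obtain ⟨π, hπ, hcyc⟩ := exists_perm_sameCycle h' t' a hcard' <| by
    intro C haC hC
    have hall : ∀ e, e ≠ z → e ∈ C := by
      refine hconn C haC fun e he hez f hfz hef => ?_
      have he' : h' e = some (h e) := (hsome _ _).2 ⟨hez, rfl⟩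
      rcases hef with hef | hef
      · by_cases hfa : f = a
        · rwa [hfa]
        · exact hC e he f (.inl (by rw [he', eq_comm, tsome]; exact ⟨hfa, hef.symm⟩))
      · exact hC e he f (.inr (by rw [he', eq_comm, hsome]; exact ⟨hfz, hef.symm⟩))
    intro e
    by_cases hez : e = z
    · -- By the balance condition some arc ends where `z` starts.
      subst hez
      have hpos : 0 < Nat.card {f // h' f = t' e} := by
        rw [hcard']
        have : Nonempty {f // t' f = t' e} := ⟨⟨e, rfl⟩⟩
        exact Nat.card_pos
      obtain ⟨⟨f, hf⟩⟩ := (Nat.card_pos_iff.1 hpos).1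
      have hfz : f ≠ e := by
        intro hfe
        rw [hfe, (hz e).2 rfl, eq_comm, ha] at hf
        exact haz hf.symm
      exact hC f (hall f hfz) e (.inl hf)
    · exact hall e hez
  -- The position of an arc is the number of steps needed to reach it from `a`.
  have hex : ∀ e, ∃ i : ℕ, (π ^ i) a = e := fun e => (hcyc e).exists_nat_pow_eq
  set idx : α → ℕ := fun e => Nat.find (hex e) with hidx
  have hspec : ∀ e, (π ^ idx e) a = e := fun e => Nat.find_spec (hex e)
  have hle : ∀ e i, (π ^ i) a = e → idx e ≤ i := fun e i hi => Nat.find_min' (hex e) hi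
  have hπz : π z = a := by rw [← ha, hπ, hz]
  have hidxz : ∀ e, idx e ≤ idx z := by
    intro e
    by_contra hlt
    push Not at hlt
    obtain ⟨k, hk⟩ := Nat.exists_eq_add_of_lt hlt
    have h1 := hspec e
    rw [hk, show idx z + k + 1 = k + (idx z + 1) by ring, pow_add, Perm.mul_apply, pow_succ',
      Perm.mul_apply, hspec z, hπz] at h1
    have := hle e k h1
    omega
  refine ⟨idx, fun e f hef => ?_, fun e => ?_, hidxz, fun e f hef hbet => ?_⟩
  · rw [← hspec e, hef, hspec f]
  · exact (hle a 0 rfl).trans (Nat.zero_le _)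
  · have hez : e ≠ z := fun he => absurd (hidxz f) (by rw [← he]; omega)
    have hfa : f ≠ a := fun hf => absurd (hle f 0 (by simp [hf])) (by omega)
    have hg1 : idx (π e) ≤ idx e + 1 :=
      hle _ _ (by rw [pow_succ', Perm.mul_apply, hspec e])
    have hg2 : idx e < idx (π e) := by
      by_contra hlt
      rcases hj : idx (π e) with _ | j
      · have h1 := hspec (π e)
        rw [hj, pow_zero, Perm.one_apply] at h1
        exact hez ((hz e).1 (by rw [← hπ, ha, ← h1]))
      · have h1 := hspec (π e)
        rw [hj, pow_succ', Perm.mul_apply] at h1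
        have := hle e j (π.injective h1)
        omega
    have hfe : f = π e := by
      have := hbet (π e)
      have hi : idx f = idx (π e) := by omega
      rw [← hspec f, hi, hspec]
    have h1 := hπ e
    rw [← hfe, (hsome e _).2 ⟨hez, rfl⟩, tsome] at h1
    exact h1.2.symm

end EulerianOrder

namespace BratteliDiagram

/-! ### Orderings adapted to a skeleton -/

/-- The ordering in which edges with the same range are compared by the values of `idx`. -/
def EdgeOrdering.ofIndex {B : BratteliDiagram} (idx : ∀ {n : ℕ}, B.Edge n → ℕ)
    (hidx : ∀ {n : ℕ} {e f : B.Edge n}, B.rng e = B.rng f → idx e = idx f → e = f) :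
    B.EdgeOrdering where
  lt e f := B.rng e = B.rng f ∧ idx e < idx f
  rng_eq_of_lt h := h.1
  irrefl _ h := lt_irrefl _ h.2
  trans h1 h2 := ⟨h1.1.trans h2.1, h1.2.trans h2.2⟩
  total h hne := (lt_or_gt_of_ne fun hi => hne (hidx h hi)).imp (⟨h, ·⟩) (⟨h.symm, ·⟩)

namespace Skeleton

theorem sum_ncard_fiber {α V : Type*} [Finite α] [DecidableEq V] (P : α → Prop) (g : α → V)
    (s : Finset V) :
    ∑ w ∈ s, {e | P e ∧ g e = w}.ncard = {e | P e ∧ g e ∈ s}.ncard := by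
  classical
  cases nonempty_fintype α
  have key : ∀ Q : α → Prop, {e | Q e}.ncard = (Finset.univ.filter Q).card := fun Q => by
    rw [Set.ncard_eq_toFinset_card', Set.toFinset_ofPred]
  simp only [key]
  rw [Finset.card_eq_sum_card_fiberwise (f := g) (t := s)]
  · refine Finset.sum_congr rfl fun w hw => congrArg Finset.card ?_
    ext e
    simp only [Finset.mem_filter, Finset.mem_univ, true_and]
    exact ⟨fun h => ⟨⟨h.1, h.2 ▸ hw⟩, h.2⟩, fun h => ⟨h.1.1, h.2⟩⟩
  · intro e he
    simp only [Finset.coe_filter, Finset.mem_univ, true_and, Set.mem_ofPred_eq] at he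
    exact he.2

variable {B : BratteliDiagram} {V : Type*} [Fintype V] {d : ℕ}
  {S : B.StrictRank V d} (F : Skeleton S)

/-- The head of an edge `e`, seen as an arc of a multigraph with vertex set `F.minV`: the minimal
vertex through which the minimal path to the source of the successor of `e` has to run if the
Vershik map is to send the maximal paths to minimal paths as `σ` prescribes. -/
def head (σ : F.maxV ≃ F.minV) {m : ℕ} (e : B.Edge (m + 1)) : F.minV :=
  σ (F.maxSrc (S.label m (B.src e)))

/-- The tail of an edge `e`, seen as an arc of a multigraph with vertex set `F.minV`: the minimal
vertex through which the minimal path to the source of `e` runs. -/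
def tail {m : ℕ} (e : B.Edge (m + 1)) : F.minV := F.minSrc (S.label m (B.src e))

/-- An ordering adapted to the skeleton and to `σ`: the selected edges are maximal and minimal, and
on all but finitely many levels the tail of the successor of an edge is the head of the edge. -/
structure IsAdapted (σ : F.maxV ≃ F.minV) (ω : B.EdgeOrdering) : Prop where
  isMaxEdge : ∀ (n : ℕ) (w : B.Vert (n + 1)), ω.IsMaxEdge (F.maxEdge n w)
  isMinEdge : ∀ (n : ℕ) (w : B.Vert (n + 1)), ω.IsMinEdge (F.minEdge n w)
  head_eq_tail : ∃ N, ∀ m, N ≤ m → ∀ e f : B.Edge (m + 1), ω.IsSuccessor e f →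
    F.head σ e = F.tail f

/-- With all heads and tails equal, Eulerian trails merely place the two selected edges first and
last; this orders the levels on which nothing is assumed. -/
theorem exists_index_fiber (n : ℕ) (w : B.Vert (n + 1)) :
    ∃ idx : {e : B.Edge n // B.rng e = w} → ℕ, Function.Injective idx ∧
      (∀ e, idx ⟨F.minEdge n w, F.rng_minEdge n w⟩ ≤ idx e) ∧
      (∀ e, idx e ≤ idx ⟨F.maxEdge n w, F.rng_maxEdge n w⟩) := by
  classical
  have : Finite (B.Edge n) := B.finite_edge _
  obtain ⟨idx, h1, h2, h3, -⟩ := EulerianOrder.exists_index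
    (α := {e : B.Edge n // B.rng e = w}) (fun _ => ()) (fun _ => ())
    (a := ⟨F.minEdge n w, F.rng_minEdge n w⟩) (z := ⟨F.maxEdge n w, F.rng_maxEdge n w⟩)
    (fun h => F.maxEdge_ne_minEdge n w (congrArg Subtype.val h).symm)
    (fun _ => Nat.card_congr ((Equiv.swap ⟨F.maxEdge n w, F.rng_maxEdge n w⟩
      ⟨F.minEdge n w, F.rng_minEdge n w⟩).subtypeEquiv fun e => by
        simp [Equiv.swap_apply_eq_iff]))
    (fun C ha hC e he => hC _ ha
      (fun h => F.maxEdge_ne_minEdge n w (congrArg Subtype.val h).symm) e he (.inl rfl))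
  exact ⟨idx, h1, h2, h3⟩

variable [DecidableEq V]

/-- Lowering one entry of a row of the incidence matrix by `1` amounts to discarding an edge. -/
theorem ite_entry_eq_ncard (m : ℕ) {u : B.Vert (m + 2)} {a : B.Edge (m + 1)} (ha : B.rng a = u)
    (w : V) :
    (if S.label m (B.src a) = w then S.entry m u w - 1 else S.entry m u w) =
      {e : B.Edge (m + 1) | (B.rng e = u ∧ e ≠ a) ∧ S.label m (B.src e) = w}.ncard := by
  have : Finite (B.Edge (m + 1)) := B.finite_edge _
  have hent : S.entry m u w =
      {e : B.Edge (m + 1) | B.rng e = u ∧ S.label m (B.src e) = w}.ncard := by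
    simp only [StrictRank.entry, incidence, Equiv.eq_symm_apply]
    rfl
  split_ifs with h
  · rw [hent, ← Set.ncard_sdiff_singleton_of_mem
      (show a ∈ {e : B.Edge (m + 1) | B.rng e = u ∧ S.label m (B.src e) = w} from ⟨ha, h⟩)]
    congr 1
    ext e
    simp only [Set.mem_sdiff, Set.mem_ofPred_eq, Set.mem_singleton_iff]
    tauto
  · rw [hent]
    congr 1
    ext e
    simp only [Set.mem_ofPred_eq]
    refine ⟨fun he => ⟨⟨he.1, ?_⟩, he.2⟩, fun he => ⟨he.1.1, he.2⟩⟩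
    rintro rfl
    exact h he.2

theorem mem_maxClass {t : F.maxV} {w : V} : w ∈ F.maxClass t ↔ F.maxSrc w = t := by
  simp [maxClass]

theorem mem_minClass {b : F.minV} {w : V} : w ∈ F.minClass b ↔ F.minSrc w = b := by
  simp [minClass]

theorem BalanceRelations.ncard_eq {F : Skeleton S} {σ : F.maxV ≃ F.minV} {m : ℕ}
    (h : F.BalanceRelations σ m) (u : B.Vert (m + 2)) (x : F.minV) :
    {e : B.Edge (m + 1) | (B.rng e = u ∧ e ≠ F.maxEdge (m + 1) u) ∧ F.head σ e = x}.ncard =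
      {e : B.Edge (m + 1) | (B.rng e = u ∧ e ≠ F.minEdge (m + 1) u) ∧ F.tail e = x}.ncard := by
  have : Finite (B.Edge (m + 1)) := B.finite_edge _
  have h1 := h u (σ.symm x)
  simp only [maxEntry, minEntry, ite_entry_eq_ncard m (F.rng_maxEdge _ _),
    ite_entry_eq_ncard m (F.rng_minEdge _ _), sum_ncard_fiber, mem_maxClass, mem_minClass,
    Equiv.apply_symm_apply, Equiv.eq_symm_apply] at h1
  exact h1

theorem crossingNumber_pos_iff (m : ℕ) (u : B.Vert (m + 2)) (p : F.GraphVertex) :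
    0 < F.crossingNumber m u p ↔ ∃ e : B.Edge (m + 1), (B.rng e = u ∧ e ≠ F.maxEdge (m + 1) u) ∧
      S.label m (B.src e) ∈ F.cell p.1.1 p.1.2 := by
  have : Finite (B.Edge (m + 1)) := B.finite_edge _
  simp only [crossingNumber, maxEntry, ite_entry_eq_ncard m (F.rng_maxEdge _ _), sum_ncard_fiber]
  rw [Set.ncard_pos]
  rfl

/-- The cell of the associated graph containing the source of an edge. -/
def cellOf {m : ℕ} (e : B.Edge (m + 1)) : F.GraphVertex :=
  ⟨(F.minSrc (S.label m (B.src e)), F.maxSrc (S.label m (B.src e))), S.label m (B.src e), by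
    simp [cell, mem_maxClass, mem_minClass]⟩

theorem mem_cell_cellOf {m : ℕ} (e : B.Edge (m + 1)) :
    S.label m (B.src e) ∈ F.cell (F.cellOf e).1.1 (F.cellOf e).1.2 := by
  simp [cell, cellOf, mem_maxClass, mem_minClass]

theorem mem_cell_iff {m : ℕ} (e : B.Edge (m + 1)) (p : F.GraphVertex) :
    S.label m (B.src e) ∈ F.cell p.1.1 p.1.2 ↔ F.cellOf e = p := by
  refine Iff.trans ?_ (Subtype.ext_iff.trans Prod.ext_iff).symm
  simp [cell, cellOf, mem_maxClass, mem_minClass]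

/-- Strong connectedness of the cells with positive crossing number makes the multigraph of the
non-maximal edges with range `u` connected. -/
theorem PositivelyStronglyConnected.mem_of_closed {F : Skeleton S} {σ : F.maxV ≃ F.minV} {m : ℕ}
    (h : F.PositivelyStronglyConnected σ m) (u : B.Vert (m + 2))
    (C : Set {e : B.Edge (m + 1) // B.rng e = u}) {a z : {e : B.Edge (m + 1) // B.rng e = u}}
    (hz : z.1 = F.maxEdge (m + 1) u) (haz : a ≠ z) (ha : a ∈ C)
    (hC : ∀ e ∈ C, e ≠ z → ∀ f, f ≠ z →
      F.head σ e.1 = F.tail f.1 ∨ F.head σ e.1 = F.head σ f.1 → f ∈ C) :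
    ∀ e, e ≠ z → e ∈ C := by
  have hpos : ∀ e : {e : B.Edge (m + 1) // B.rng e = u}, e ≠ z →
      0 < F.crossingNumber m u (F.cellOf e.1) := fun e he =>
    (F.crossingNumber_pos_iff m u _).2
      ⟨e.1, ⟨e.2, fun h => he (Subtype.ext (h.trans hz.symm))⟩, F.mem_cell_cellOf _⟩
  intro e he
  have hreach := h u ⟨F.cellOf a.1, hpos a haz⟩ ⟨F.cellOf e.1, hpos e he⟩
  -- All edges of all cells reachable from the cell of `a` lie in `C`.
  have key : ∀ q : {p : F.GraphVertex // 0 < F.crossingNumber m u p},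
      Relation.ReflTransGen (fun a b : {p : F.GraphVertex // 0 < F.crossingNumber m u p} =>
        (F.graph σ).Adj a.1 b.1) ⟨F.cellOf a.1, hpos a haz⟩ q →
      ∀ g : {e : B.Edge (m + 1) // B.rng e = u}, g ≠ z → F.cellOf g.1 = q.1 → g ∈ C := by
    intro q hq
    induction hq with
    | refl =>
      intro g hg hgq
      -- Edges of the same cell have the same head, so no closed walk through the cell is needed.
      refine hC a ha haz g hg (.inr ?_)
      exact congrArg (fun p : F.GraphVertex => σ p.1.2) hgq.symm
    | @tail b c _ hbc ih =>
      intro g hg hgc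
      obtain ⟨f, ⟨hf, hfm⟩, hfb⟩ := (F.crossingNumber_pos_iff m u b.1).1 b.2
      rw [mem_cell_iff] at hfb
      have hfz : (⟨f, hf⟩ : {e : B.Edge (m + 1) // B.rng e = u}) ≠ z := fun h =>
        hfm (by rw [← hz, ← h])
      refine hC _ (ih ⟨f, hf⟩ hfz hfb) hfz g hg (.inl ?_)
      have hadj : σ b.1.1.2 = c.1.1.1 := hbc
      rw [← hfb, ← hgc] at hadj
      exact hadj
  exact key _ hreach e he rfl

theorem exists_index_fiber_of_balance {σ : F.maxV ≃ F.minV} {m : ℕ}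
    (hconn : F.PositivelyStronglyConnected σ m) (hbal : F.BalanceRelations σ m)
    (u : B.Vert (m + 2)) :
    ∃ idx : {e : B.Edge (m + 1) // B.rng e = u} → ℕ, Function.Injective idx ∧
      (∀ e, idx ⟨F.minEdge (m + 1) u, F.rng_minEdge (m + 1) u⟩ ≤ idx e) ∧
      (∀ e, idx e ≤ idx ⟨F.maxEdge (m + 1) u, F.rng_maxEdge (m + 1) u⟩) ∧
      ∀ e f, idx e < idx f → (∀ g, ¬ (idx e < idx g ∧ idx g < idx f)) →
        F.head σ e.1 = F.tail f.1 := by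
  have : Finite (B.Edge (m + 1)) := B.finite_edge _
  have hne : (⟨F.minEdge (m + 1) u, F.rng_minEdge (m + 1) u⟩ :
      {e : B.Edge (m + 1) // B.rng e = u}) ≠ ⟨F.maxEdge (m + 1) u, F.rng_maxEdge (m + 1) u⟩ :=
    fun h => F.maxEdge_ne_minEdge _ u (congrArg Subtype.val h).symm
  refine EulerianOrder.exists_index (fun e => F.head σ e.1) (fun e => F.tail e.1) hne
    (fun x => ?_) (fun C ha hC => hconn.mem_of_closed u C rfl hne ha hC)
  have hsub : ∀ (a : B.Edge (m + 1)) (ha : B.rng a = u) (k : B.Edge (m + 1) → F.minV),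
      Nat.card {e : {e : B.Edge (m + 1) // B.rng e = u} // e ≠ ⟨a, ha⟩ ∧ k e.1 = x} =
        {e : B.Edge (m + 1) | (B.rng e = u ∧ e ≠ a) ∧ k e = x}.ncard := fun a ha k =>
    Nat.card_congr
      { toFun := fun e => ⟨e.1.1, ⟨e.1.2, fun h => e.2.1 (Subtype.ext h)⟩, e.2.2⟩
        invFun := fun e =>
          ⟨⟨e.1, e.2.1.1⟩, fun h => e.2.1.2 (congrArg Subtype.val h), e.2.2⟩
        left_inv := fun _ => rfl
        right_inv := fun _ => rfl }
  rw [hsub _ _ (F.head σ), hsub _ _ F.tail]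
  exact hbal.ncard_eq u x

theorem exists_isAdapted (σ : F.maxV ≃ F.minV)
    (hconn : ∀ᶠ m in Filter.atTop, F.PositivelyStronglyConnected σ m)
    (hbal : ∀ᶠ m in Filter.atTop, F.BalanceRelations σ m) :
    ∃ ω : B.EdgeOrdering, F.IsAdapted σ ω := by
  obtain ⟨N, hN⟩ := Filter.eventually_atTop.1 (hconn.and hbal)
  have hex : ∀ (n : ℕ) (w : B.Vert (n + 1)),
      ∃ idx : {e : B.Edge n // B.rng e = w} → ℕ, Function.Injective idx ∧
        (∀ e, idx ⟨F.minEdge n w, F.rng_minEdge n w⟩ ≤ idx e) ∧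
        (∀ e, idx e ≤ idx ⟨F.maxEdge n w, F.rng_maxEdge n w⟩) ∧
        -- Heads and tails are defined only for edges of index `m + 1`, hence the transport by `hm`.
        ∀ m (hm : n = m + 1), N ≤ m → ∀ e f, idx e < idx f →
          (∀ g, ¬ (idx e < idx g ∧ idx g < idx f)) →
            F.head σ (hm ▸ e.1) = F.tail (hm ▸ f.1) := by
    intro n w
    by_cases h : ∃ m, n = m + 1 ∧ N ≤ m
    · obtain ⟨m, rfl, hm⟩ := h
      obtain ⟨idx, h1, h2, h3, h4⟩ :=
        F.exists_index_fiber_of_balance (hN m hm).1 (hN m hm).2 w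
      refine ⟨idx, h1, h2, h3, fun m' hm' _ => ?_⟩
      obtain rfl : m = m' := Nat.succ_injective hm'
      exact h4
    · obtain ⟨idx, h1, h2, h3⟩ := F.exists_index_fiber n w
      exact ⟨idx, h1, h2, h3, fun m hm hNm => absurd ⟨m, hm, hNm⟩ h⟩
  choose idx hinj hmin hmax hsucc using hex
  have hval : ∀ {n : ℕ} {w : B.Vert (n + 1)} (e : B.Edge n) (he : B.rng e = w),
      idx n (B.rng e) ⟨e, rfl⟩ = idx n w ⟨e, he⟩ := by
    rintro n w e rfl
    rfl
  refine ⟨EdgeOrdering.ofIndex (fun {n} e => idx n (B.rng e) ⟨e, rfl⟩) ?_, ?_, ?_, N, ?_⟩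
  · intro n e f hef h
    rw [hval e hef] at h
    exact congrArg Subtype.val (hinj _ _ h)
  · rintro n w f ⟨hr, hlt⟩
    rw [F.rng_maxEdge] at hr
    replace hlt := (hval _ (F.rng_maxEdge n w)).symm.trans_lt (hlt.trans_eq (hval f hr.symm))
    exact absurd (hmax n w ⟨f, hr.symm⟩) (not_le.2 hlt)
  · rintro n w f ⟨hr, hlt⟩
    rw [F.rng_minEdge] at hr
    replace hlt := (hval f hr).symm.trans_lt (hlt.trans_eq (hval _ (F.rng_minEdge n w)))
    exact absurd (hmin n w ⟨f, hr⟩) (not_le.2 hlt)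
  · rintro m hm e f ⟨⟨hr, hlt⟩, hbet⟩
    refine hsucc (m + 1) (B.rng f) m rfl hm ⟨e, hr⟩ ⟨f, rfl⟩ ?_ ?_
    · rwa [← hval e hr]
    · rintro ⟨g, hg⟩ hgb
      rw [← hval e hr, ← hval g hg] at hgb
      exact hbet g ⟨⟨hr.trans hg.symm, hgb.1⟩, hg, hgb.2⟩

end Skeleton

end BratteliDiagram

namespace BratteliDiagram

/-! ### The topology of the path space -/

section Topology

variable {B : BratteliDiagram}

theorem PathSpace.ext {x y : B.PathSpace} (h : ∀ n, x.1 n = y.1 n) : x = y :=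
  Subtype.ext (funext h)

theorem PathSpace.continuous_apply (n : ℕ) :
    @Continuous B.PathSpace (B.Edge n) _ ⊥ fun x => x.1 n := by
  let _ : ∀ n, TopologicalSpace (B.Edge n) := fun _ => ⊥
  exact (_root_.continuous_apply n).comp continuous_induced_dom

theorem PathSpace.t2Space (B : BratteliDiagram) : T2Space B.PathSpace := by
  let _ : ∀ n, TopologicalSpace (B.Edge n) := fun _ => ⊥
  have : ∀ n, DiscreteTopology (B.Edge n) := fun _ => ⟨rfl⟩
  exact T2Space.of_injective_continuous (f := fun x : B.PathSpace => x.1)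
    Subtype.val_injective continuous_induced_dom

theorem PathSpace.eventually_apply_eq (x : B.PathSpace) (n : ℕ) :
    ∀ᶠ y in nhds x, y.1 n = x.1 n := by
  let _ : TopologicalSpace (B.Edge n) := ⊥
  have : DiscreteTopology (B.Edge n) := ⟨rfl⟩
  exact (PathSpace.continuous_apply n).continuousAt.eventually
    (show ∀ᶠ e in nhds (x.1 n), e = x.1 n by simp [nhds_discrete])

theorem PathSpace.tendsto_of_eventually_apply_eq {ι : Type*} {l : Filter ι} {f : ι → B.PathSpace}
    {x : B.PathSpace} (h : ∀ n, ∀ᶠ i in l, (f i).1 n = x.1 n) : Filter.Tendsto f l (nhds x) := by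
  let _ : ∀ n, TopologicalSpace (B.Edge n) := fun _ => ⊥
  have hind : Topology.IsInducing (fun x : B.PathSpace => x.1) := ⟨rfl⟩
  rw [hind.tendsto_nhds_iff, tendsto_pi_nhds]
  exact fun n => tendsto_nhds_of_eventually_eq (h n)

theorem PathSpace.continuous_of_forall_exists {φ : B.PathSpace → B.PathSpace}
    (h : ∀ x n, ∃ N, ∀ x' : B.PathSpace, (∀ i < N, x'.1 i = x.1 i) →
      (φ x').1 n = (φ x).1 n) : Continuous φ := by
  refine continuous_iff_continuousAt.2 fun x =>
    PathSpace.tendsto_of_eventually_apply_eq fun n => ?_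
  obtain ⟨N, hN⟩ := h x n
  have hev : ∀ᶠ x' in nhds x, ∀ i ∈ Finset.range N, x'.1 i = x.1 i :=
    (Filter.eventually_all_finset _).2 fun i _ => PathSpace.eventually_apply_eq x i
  exact hev.mono fun x' hx' => hN x' fun i hi => hx' i (Finset.mem_range.2 hi)

end Topology

/-! ### Successors of paths -/

namespace EdgeOrdering

variable {B : BratteliDiagram} (ω : B.EdgeOrdering)

/-- The opposite ordering. -/
def rev : B.EdgeOrdering where
  lt e f := ω.lt f e
  rng_eq_of_lt h := (ω.rng_eq_of_lt h).symm
  irrefl e := ω.irrefl e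
  trans h1 h2 := ω.trans h2 h1
  total h hne := ω.total h.symm hne.symm

variable {ω}

theorem rev_isSuccessor {n : ℕ} {e f : B.Edge n} :
    ω.rev.IsSuccessor e f ↔ ω.IsSuccessor f e :=
  and_congr_right fun _ => forall_congr' fun _ => not_congr and_comm

theorem IsMaxEdge.eq {n : ℕ} {e f : B.Edge n} (he : ω.IsMaxEdge e) (hf : ω.IsMaxEdge f)
    (h : B.rng e = B.rng f) : e = f := by
  by_contra hne
  exact (ω.total h hne).elim (he f) (hf e)

theorem IsMinEdge.eq {n : ℕ} {e f : B.Edge n} (he : ω.IsMinEdge e) (hf : ω.IsMinEdge f)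
    (h : B.rng e = B.rng f) : e = f :=
  IsMaxEdge.eq (ω := ω.rev) he hf h

theorem IsSuccessor.not_isMaxEdge {n : ℕ} {e f : B.Edge n} (h : ω.IsSuccessor e f) :
    ¬ ω.IsMaxEdge e := fun he => he f h.1

theorem IsSuccessor.eq {n : ℕ} {e f g : B.Edge n} (hf : ω.IsSuccessor e f)
    (hg : ω.IsSuccessor e g) : f = g := by
  by_contra hne
  rcases ω.total ((ω.rng_eq_of_lt hf.1).symm.trans (ω.rng_eq_of_lt hg.1)) hne with h | h
  · exact hg.2 f ⟨hf.1, h⟩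
  · exact hf.2 g ⟨hg.1, h⟩

theorem exists_isSuccessor {n : ℕ} {e : B.Edge n} (he : ¬ ω.IsMaxEdge e) :
    ∃ f, ω.IsSuccessor e f := by
  have : Finite (B.Edge n) := B.finite_edge n
  have : IsTrans (B.Edge n) ω.lt := ⟨fun _ _ _ => ω.trans⟩
  have : Std.Irrefl (ω.lt (n := n)) := ⟨ω.irrefl⟩
  have hne : ∃ f, ω.lt e f := by simpa [IsMaxEdge] using he
  obtain ⟨f, hf, hmin⟩ :=
    (Finite.wellFounded_of_trans_of_irrefl (ω.lt (n := n))).has_min {f | ω.lt e f} hne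
  exact ⟨f, hf, fun g hg => hmin g hg.1 hg.2⟩

variable (ω)

/-- `y` is the successor of `x`, and `k` is the index of the first non-maximal edge of `x`. -/
structure StepAt (k : ℕ) (x y : B.PathSpace) : Prop where
  isMaxEdge : ∀ i < k, ω.IsMaxEdge (x.1 i)
  isMinEdge : ∀ i < k, ω.IsMinEdge (y.1 i)
  isSuccessor : ω.IsSuccessor (x.1 k) (y.1 k)
  eq_of_gt : ∀ i > k, y.1 i = x.1 i

variable {ω}

theorem StepAt.rev {k : ℕ} {x y : B.PathSpace} (h : ω.StepAt k x y) : ω.rev.StepAt k y x where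
  isMaxEdge := h.isMinEdge
  isMinEdge := h.isMaxEdge
  isSuccessor := rev_isSuccessor.2 h.isSuccessor
  eq_of_gt i hi := (h.eq_of_gt i hi).symm

theorem StepAt.notMem_maxPaths {k : ℕ} {x y : B.PathSpace} (h : ω.StepAt k x y) :
    x ∉ ω.maxPaths := fun hx => h.isSuccessor.not_isMaxEdge (hx k)

theorem StepAt.index_eq {k k' : ℕ} {x x' y y' : B.PathSpace} (h : ω.StepAt k x y)
    (h' : ω.StepAt k' x' y') (hx : ∀ i ≤ k, x'.1 i = x.1 i) : k' = k := by
  rcases lt_trichotomy k' k with hlt | heq | hlt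
  · exact absurd (hx k' hlt.le ▸ h.isMaxEdge k' hlt) h'.isSuccessor.not_isMaxEdge
  · exact heq
  · exact absurd (hx k le_rfl ▸ h'.isMaxEdge k hlt) h.isSuccessor.not_isMaxEdge

/-- The edges of the successor up to the first non-maximal index `k` depend only on the edge of
index `k`. -/
theorem StepAt.apply_eq {k : ℕ} {x x' y y' : B.PathSpace} (h : ω.StepAt k x y)
    (h' : ω.StepAt k x' y') (hx : x'.1 k = x.1 k) : ∀ i ≤ k, y'.1 i = y.1 i := by
  intro i hi
  induction hi using Nat.decreasingInduction with
  | self => exact (hx ▸ h'.isSuccessor).eq h.isSuccessor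
  | of_succ i hi ih =>
    exact (h'.isMinEdge i hi).eq (h.isMinEdge i hi) (by rw [y'.2, y.2, ih])

theorem StepAt.unique {k k' : ℕ} {x y y' : B.PathSpace} (h : ω.StepAt k x y)
    (h' : ω.StepAt k' x y') : y = y' := by
  obtain rfl := h.index_eq h' fun _ _ => rfl
  refine PathSpace.ext fun i => ?_
  rcases le_or_gt i k' with hi | hi
  · exact h'.apply_eq h rfl i hi
  · rw [h.eq_of_gt i hi, h'.eq_of_gt i hi]

/-- A sequence of edges which is a path from level `k` on can be completed by minimal edges. -/
theorem exists_path_of_minEdge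
    (hmin : ∀ (n : ℕ) (w : B.Vert (n + 1)), ∃ e : B.Edge n, B.rng e = w ∧ ω.IsMinEdge e)
    (k : ℕ) (x : ∀ n, B.Edge n) (hx : ∀ i ≥ k, B.rng (x i) = B.src (x (i + 1))) :
    ∃ y : B.PathSpace, (∀ i < k, ω.IsMinEdge (y.1 i)) ∧ ∀ i ≥ k, y.1 i = x i := by
  induction k generalizing x with
  | zero => exact ⟨⟨x, fun n => hx n (Nat.zero_le n)⟩, by simp, fun _ _ => rfl⟩
  | succ k ih =>
    obtain ⟨e, he, hemin⟩ := hmin k (B.src (x (k + 1)))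
    obtain ⟨y, hy1, hy2⟩ := ih (Function.update x k e) fun i hi => by
      rw [Function.update_of_ne (by omega : i + 1 ≠ k)]
      rcases eq_or_lt_of_le hi with rfl | hi
      · rw [Function.update_self, he]
      · rw [Function.update_of_ne hi.ne', hx i hi]
    refine ⟨y, fun i hi => ?_, fun i hi => ?_⟩
    · rcases eq_or_lt_of_le (Nat.lt_succ_iff.1 hi) with rfl | hi
      · rw [hy2 i le_rfl, Function.update_self]
        exact hemin
      · exact hy1 i hi
    · rw [hy2 i (by omega), Function.update_of_ne (by omega)]

theorem exists_stepAt
    (hmin : ∀ (n : ℕ) (w : B.Vert (n + 1)), ∃ e : B.Edge n, B.rng e = w ∧ ω.IsMinEdge e)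
    {x : B.PathSpace} (hx : x ∉ ω.maxPaths) : ∃ k y, ω.StepAt k x y := by
  classical
  have hex : ∃ k, ¬ ω.IsMaxEdge (x.1 k) := not_forall.1 hx
  obtain ⟨k, hk, hlt⟩ : ∃ k, ¬ ω.IsMaxEdge (x.1 k) ∧ ∀ i < k, ω.IsMaxEdge (x.1 i) :=
    ⟨Nat.find hex, Nat.find_spec hex, fun i hi => not_not.1 (Nat.find_min hex hi)⟩
  obtain ⟨f, hf⟩ := exists_isSuccessor hk
  obtain ⟨y, hy1, hy2⟩ := exists_path_of_minEdge hmin k (Function.update x.1 k f) fun i hi => by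
    rw [Function.update_of_ne (by omega : i + 1 ≠ k)]
    rcases eq_or_lt_of_le hi with rfl | hi
    · rw [Function.update_self, ← ω.rng_eq_of_lt hf.1, x.2]
    · rw [Function.update_of_ne hi.ne', x.2]
  refine ⟨k, y, hlt, hy1, ?_, fun i hi => ?_⟩
  · rwa [hy2 k le_rfl, Function.update_self]
  · rw [hy2 i hi.le, Function.update_of_ne hi.ne']

theorem IsVershikMap.stepAt {φ : B.PathSpace ≃ₜ B.PathSpace} (hφ : ω.IsVershikMap φ)
    {x : B.PathSpace} (hx : x ∉ ω.maxPaths) : ∃ k, ω.StepAt k x (φ x) := by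
  classical
  have hex : ∃ k, ¬ ω.IsMaxEdge (x.1 k) := not_forall.1 hx
  have hlt : ∀ i < Nat.find hex, ω.IsMaxEdge (x.1 i) := fun i hi =>
    not_not.1 (Nat.find_min hex hi)
  obtain ⟨h1, h2, h3⟩ := hφ.apply_of_not_max x _ hlt (Nat.find_spec hex)
  exact ⟨Nat.find hex, hlt, h1, h2, h3⟩

end EdgeOrdering

/-! ### The Vershik map of an adapted ordering -/

namespace Skeleton

variable {B : BratteliDiagram} {V : Type*} [Fintype V] {d : ℕ}
  {S : B.StrictRank V d} (F : Skeleton S)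

/-- The skeleton with the roles of maximal and minimal edges exchanged. -/
def rev : Skeleton S where
  maxV := F.minV
  minV := F.maxV
  card_maxV_eq := F.card_maxV_eq.symm
  maxPath := F.minPath
  minPath := F.maxPath
  maxPath_vertical := F.minPath_vertical
  minPath_vertical := F.maxPath_vertical
  maxSrc := F.minSrc
  minSrc := F.maxSrc
  maxEdge := F.minEdge
  minEdge := F.maxEdge
  rng_maxEdge := F.rng_minEdge
  rng_minEdge := F.rng_maxEdge
  maxEdge_ne_minEdge n w := (F.maxEdge_ne_minEdge n w).symm
  src_maxEdge := F.src_minEdge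
  src_minEdge := F.src_maxEdge
  maxEdge_eq := F.minEdge_eq
  minEdge_eq := F.maxEdge_eq

variable {F} {σ : F.maxV ≃ F.minV} {ω : B.EdgeOrdering}

theorem IsAdapted.rev (h : F.IsAdapted σ ω) : F.rev.IsAdapted σ.symm ω.rev where
  isMaxEdge := h.isMinEdge
  isMinEdge := h.isMaxEdge
  head_eq_tail := by
    obtain ⟨N, hN⟩ := h.head_eq_tail
    refine ⟨N, fun m hm e f hef => ?_⟩
    have := hN m hm f e (EdgeOrdering.rev_isSuccessor.1 hef)
    exact (Equiv.symm_apply_eq σ).2 this.symm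

theorem maxPath_injective : Function.Injective F.maxPath := fun v v' h =>
  Subtype.ext <| by rw [← F.maxPath_vertical v 0, h, F.maxPath_vertical]

theorem maxSrc_coe (v : F.maxV) : F.maxSrc v = v := by
  refine Subtype.ext ?_
  have h := F.src_maxEdge 0 ((S.label 1).symm v)
  rw [F.maxEdge_eq, Equiv.apply_symm_apply, ← (F.maxPath v).2 0, F.maxPath_vertical] at h
  exact h.symm

theorem IsAdapted.eq_maxEdge (h : F.IsAdapted σ ω) {n : ℕ} {e : B.Edge n} (he : ω.IsMaxEdge e) :
    e = F.maxEdge n (B.rng e) :=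
  he.eq (h.isMaxEdge _ _) (F.rng_maxEdge _ _).symm

/-- If the edges up to index `k` are maximal, then the vertices reached before index `k` all carry
the same label, because a maximal vertex is its own maximal source. -/
theorem IsAdapted.label_rng (h : F.IsAdapted σ ω) {x : B.PathSpace} {k : ℕ}
    (hx : ∀ i ≤ k, ω.IsMaxEdge (x.1 i)) :
    ∀ i < k, S.label i (B.rng (x.1 i)) = F.maxSrc (S.label k (B.rng (x.1 k))) := by
  have hstep : ∀ i < k,
      S.label i (B.rng (x.1 i)) = F.maxSrc (S.label (i + 1) (B.rng (x.1 (i + 1)))) := by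
    intro i hi
    rw [x.2 i, ← F.src_maxEdge, ← h.eq_maxEdge (hx (i + 1) hi)]
  intro i hi
  obtain ⟨j, rfl⟩ : ∃ j, k = j + 1 := ⟨k - 1, by omega⟩
  have hij : i ≤ j := by omega
  induction hij using Nat.decreasingInduction with
  | self => exact hstep j (Nat.lt_succ_self j)
  | of_succ i hi ih => rw [hstep i (by omega), ih (by omega), maxSrc_coe]

/-- If the edges up to index `k` are maximal, then below index `k` the path follows the vertical
maximal path determined by the vertex reached by the edge of index `k`. -/
theorem IsAdapted.apply_eq_maxPath (h : F.IsAdapted σ ω) {x : B.PathSpace} {k : ℕ}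
    (hx : ∀ i ≤ k, ω.IsMaxEdge (x.1 i)) :
    ∀ i < k, x.1 i = (F.maxPath (F.maxSrc (S.label k (B.rng (x.1 k))))).1 i := by
  intro i hi
  rw [h.eq_maxEdge (hx i hi.le), ← F.maxEdge_eq, ← h.label_rng hx i hi, Equiv.symm_apply_apply]

theorem IsAdapted.isMaxEdge_maxPath (h : F.IsAdapted σ ω) (v : F.maxV) (n : ℕ) :
    ω.IsMaxEdge ((F.maxPath v).1 n) := by
  rw [← F.maxEdge_eq]
  exact h.isMaxEdge _ _

theorem IsAdapted.maxPaths_eq (h : F.IsAdapted σ ω) : ω.maxPaths = Set.range F.maxPath := by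
  ext x
  constructor
  · intro hx
    have hconst : ∀ k, F.maxSrc (S.label (k + 1) (B.rng (x.1 (k + 1)))) =
        F.maxSrc (S.label 1 (B.rng (x.1 1))) := fun k => Subtype.ext <|
      (h.label_rng (fun i _ => hx i) 0 (Nat.succ_pos k)).symm.trans
        (h.label_rng (fun i _ => hx i) 0 one_pos)
    refine ⟨F.maxSrc (S.label 1 (B.rng (x.1 1))), PathSpace.ext fun i => ?_⟩
    exact ((h.apply_eq_maxPath (fun i _ => hx i) i (Nat.lt_succ_self i)).trans
      (congrArg (fun v => (F.maxPath v).1 i) (hconst i))).symm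
  · rintro ⟨v, rfl⟩
    exact h.isMaxEdge_maxPath v

theorem IsAdapted.minPaths_eq (h : F.IsAdapted σ ω) : ω.minPaths = Set.range F.minPath :=
  h.rev.maxPaths_eq

theorem IsAdapted.isSkeletonOf (h : F.IsAdapted σ ω) : F.IsSkeletonOf ω where
  isMaxEdge := h.isMaxEdge
  isMinEdge := h.isMinEdge
  maxPaths_eq := h.maxPaths_eq
  minPaths_eq := h.minPaths_eq

variable (F σ ω) in
/-- The graph of the Vershik map: a maximal path is related to the minimal path prescribed by
`σ`, and any other path to its successor. -/
def VershikRel (x y : B.PathSpace) : Prop :=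
  (∃ v, x = F.maxPath v ∧ y = F.minPath (σ v)) ∨ ∃ k, ω.StepAt k x y

theorem VershikRel.rev {x y : B.PathSpace} (h : F.VershikRel σ ω x y) :
    F.rev.VershikRel σ.symm ω.rev y x := by
  rcases h with ⟨v, rfl, rfl⟩ | ⟨k, h⟩
  · exact .inl ⟨σ v, rfl, congrArg F.maxPath (σ.symm_apply_apply v).symm⟩
  · exact .inr ⟨k, h.rev⟩

theorem IsAdapted.exists_vershikRel (h : F.IsAdapted σ ω) (x : B.PathSpace) :
    ∃ y, F.VershikRel σ ω x y := by
  by_cases hx : x ∈ ω.maxPaths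
  · rw [h.maxPaths_eq] at hx
    obtain ⟨v, rfl⟩ := hx
    exact ⟨_, .inl ⟨v, rfl, rfl⟩⟩
  · obtain ⟨k, y, hy⟩ := EdgeOrdering.exists_stepAt
      (fun n w => ⟨F.minEdge n w, F.rng_minEdge n w, h.isMinEdge n w⟩) hx
    exact ⟨y, .inr ⟨k, hy⟩⟩

theorem IsAdapted.vershikRel_unique (h : F.IsAdapted σ ω) {x y y' : B.PathSpace}
    (hy : F.VershikRel σ ω x y) (hy' : F.VershikRel σ ω x y') : y = y' := by
  rcases hy with ⟨v, rfl, rfl⟩ | ⟨k, hk⟩ <;> rcases hy' with ⟨v', hx', rfl⟩ | ⟨k', hk'⟩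
  · rw [maxPath_injective hx']
  · exact absurd (h.isMaxEdge_maxPath v) hk'.notMem_maxPaths
  · rw [hx'] at hk
    exact absurd (h.isMaxEdge_maxPath v') hk.notMem_maxPaths
  · exact hk.unique hk'

/-- Near a maximal path `M`, the first non-maximal index `k` is large. The prescribed source of
the successor edge of index `k` then forces the minimal path to it to follow the vertical path
which `σ` assigns to `M`; this gives continuity at `M`. -/
theorem IsAdapted.continuous_of_vershikRel (h : F.IsAdapted σ ω) {φ : B.PathSpace → B.PathSpace}
    (hφ : ∀ x, F.VershikRel σ ω x (φ x)) : Continuous φ := by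
  obtain ⟨N, hN⟩ := h.head_eq_tail
  refine PathSpace.continuous_of_forall_exists fun x n => ?_
  rcases hφ x with ⟨v, rfl, hy⟩ | ⟨k, hk⟩
  · refine ⟨max n N + 2, fun x' hx' => ?_⟩
    rcases hφ x' with ⟨v', rfl, hy'⟩ | ⟨k', hk'⟩
    · have hv : v' = v := Subtype.ext <| by
        rw [← F.maxPath_vertical v' 0, hx' 0 (by omega), F.maxPath_vertical]
      rw [hy, hy', hv]
    · have hle : max n N + 2 ≤ k' := by
        by_contra hlt
        refine hk'.isSuccessor.not_isMaxEdge ?_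
        rw [hx' k' (by omega)]
        exact h.isMaxEdge_maxPath v k'
      obtain ⟨j, rfl⟩ : ∃ j, k' = j + 1 := ⟨k' - 1, by omega⟩
      have hmax := h.apply_eq_maxPath fun i (hi : i ≤ j) => hk'.isMaxEdge i (by omega)
      have hmin := h.rev.apply_eq_maxPath (x := φ x') fun i (hi : i ≤ j) =>
        hk'.isMinEdge i (by omega)
      have hht := hN j (by omega) _ _ hk'.isSuccessor
      have hv : F.maxSrc (S.label j (B.rng (x'.1 j))) = v := Subtype.ext <| by
        rw [← F.maxPath_vertical _ 0, ← hmax 0 (by omega), hx' 0 (by omega), F.maxPath_vertical]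
      rw [head, tail, ← x'.2, ← (φ x').2, hv] at hht
      rw [hmin n (by omega), hy, hht]
      rfl
  · refine ⟨max n k + 1, fun x' hx' => ?_⟩
    have hnot : ¬ ω.IsMaxEdge (x'.1 k) := by
      rw [hx' k (by omega)]
      exact hk.isSuccessor.not_isMaxEdge
    rcases hφ x' with ⟨v', rfl, -⟩ | ⟨k', hk'⟩
    · exact absurd (h.isMaxEdge_maxPath v' k) hnot
    · obtain rfl := hk.index_eq hk' fun i hi => hx' i (by omega)
      rcases le_or_gt n k' with hn | hn
      · exact hk.apply_eq hk' (hx' k' (by omega)) n hn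
      · rw [hk.eq_of_gt n hn, hk'.eq_of_gt n hn, hx' n (by omega)]

theorem IsAdapted.exists_homeomorph (h : F.IsAdapted σ ω) :
    ∃ φ : B.PathSpace ≃ₜ B.PathSpace, ∀ x, F.VershikRel σ ω x (φ x) := by
  choose φ hφ using h.exists_vershikRel
  choose ψ hψ using h.rev.exists_vershikRel
  exact ⟨{
    toFun := φ
    invFun := ψ
    left_inv := fun x => h.rev.vershikRel_unique (hψ (φ x)) (hφ x).rev
    right_inv := fun y => h.vershikRel_unique (hφ (ψ y)) (hψ y).rev
    continuous_toFun := h.continuous_of_vershikRel hφ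
    continuous_invFun := h.rev.continuous_of_vershikRel hψ }, hφ⟩

theorem IsAdapted.isVershikMap (h : F.IsAdapted σ ω) {φ : B.PathSpace ≃ₜ B.PathSpace}
    (hφ : ∀ x, F.VershikRel σ ω x (φ x)) : ω.IsVershikMap φ where
  image_maxPaths := by
    have hv : ∀ v, φ (F.maxPath v) = F.minPath (σ v) := fun v =>
      h.vershikRel_unique (hφ _) (.inl ⟨v, rfl, rfl⟩)
    rw [h.maxPaths_eq, h.minPaths_eq, ← Set.range_comp, ← σ.surjective.range_comp F.minPath]
    exact congrArg Set.range (funext hv)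
  apply_of_not_max x k hlt hk := by
    rcases hφ x with ⟨v, rfl, -⟩ | ⟨k', hk'⟩
    · exact absurd (h.isMaxEdge_maxPath v k) hk
    · have hkk : k' = k := by
        rcases lt_trichotomy k' k with hl | he | hl
        · exact absurd (hlt k' hl) hk'.isSuccessor.not_isMaxEdge
        · exact he
        · exact absurd (hk'.isMaxEdge k hl) hk
      subst hkk
      exact ⟨hk'.isMinEdge, hk'.isSuccessor, hk'.eq_of_gt⟩

end Skeleton

/-! ### Uniqueness of the Vershik map -/

/-- A path can be made to follow any connection from the end of its edge of index `n` to the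
source of an edge `g`. -/
theorem HasPath.exists_edges {B : BratteliDiagram} (x : B.PathSpace) (n : ℕ) {m : ℕ}
    {w : B.Vert m} (h : B.HasPath (B.rng (x.1 n)) w) :
    n < m ∧ ∀ g : B.Edge m, B.src g = w → ∃ z : ∀ i, B.Edge i,
      (∀ i ≤ n, z i = x.1 i) ∧ z m = g ∧ ∀ i < m, B.rng (z i) = B.src (z (i + 1)) := by
  induction h with
  | nil =>
    refine ⟨Nat.lt_succ_self n, fun g hg => ⟨Function.update x.1 (n + 1) g, fun i hi => ?_,
      Function.update_self .., fun i hi => ?_⟩⟩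
    · exact Function.update_of_ne (by omega) _ _
    · rw [Function.update_of_ne (by omega : i ≠ n + 1)]
      rcases eq_or_lt_of_le (Nat.lt_succ_iff.1 hi) with rfl | hi
      · rw [Function.update_self, hg]
      · rw [Function.update_of_ne (by omega), x.2]
  | @cons m e _ ih =>
    refine ⟨ih.1.trans (Nat.lt_succ_self m), fun g hg => ?_⟩
    obtain ⟨z, hz1, hz2, hz3⟩ := ih.2 e rfl
    have hnm := ih.1
    refine ⟨Function.update z (m + 1) g, fun i hi => ?_, Function.update_self .., fun i hi => ?_⟩
    · rw [Function.update_of_ne (by omega), hz1 i hi]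
    · rw [Function.update_of_ne (by omega : i ≠ m + 1)]
      rcases eq_or_lt_of_le (Nat.lt_succ_iff.1 hi) with rfl | hi
      · rw [Function.update_self, hz2, hg]
      · rw [Function.update_of_ne (by omega), hz3 i hi]

namespace Skeleton

variable {B : BratteliDiagram} {V : Type*} [Fintype V] {d : ℕ}
  {S : B.StrictRank V d} {F : Skeleton S} {σ : F.maxV ≃ F.minV} {ω : B.EdgeOrdering}

/-- In a simple diagram, maximal paths are limits of non-maximal ones: a path may leave the
maximal path and return to it through the minimal edge at one of its vertices. -/
theorem IsAdapted.exists_notMem_maxPaths (h : F.IsAdapted σ ω) (hB : B.IsSimple) (v : F.maxV)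
    (n : ℕ) : ∃ x : B.PathSpace, x ∉ ω.maxPaths ∧ ∀ i ≤ n, x.1 i = (F.maxPath v).1 i := by
  obtain ⟨m, hm, hpath⟩ := hB (n + 1)
  set M := F.maxPath v with hM
  set g := F.minEdge m (B.rng (M.1 m)) with hg
  have hgr : B.rng g = B.rng (M.1 m) := F.rng_minEdge _ _
  obtain ⟨-, hz⟩ := HasPath.exists_edges M n (hpath (B.rng (M.1 n)) (B.src g))
  obtain ⟨z, hz1, hz2, hz3⟩ := hz g rfl
  refine ⟨⟨fun i => if i ≤ m then z i else M.1 i, fun i => ?_⟩, fun hx => ?_, fun i hi => ?_⟩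
  · beta_reduce
    rcases lt_trichotomy i m with hi | rfl | hi
    · rw [if_pos hi.le, if_pos (by omega), hz3 i hi]
    · rw [if_pos le_rfl, if_neg (by omega), hz2, hgr, M.2]
    · rw [if_neg (by omega), if_neg (by omega), M.2]
  · have hxm := hx m
    simp only [le_refl, if_true, hz2] at hxm
    have h1 := h.eq_maxEdge hxm
    rw [hgr, hg] at h1
    exact F.maxEdge_ne_minEdge _ _ h1.symm
  · show (if i ≤ m then z i else M.1 i) = M.1 i
    rw [if_pos (by omega), hz1 i hi]

theorem IsAdapted.apply_maxPath (h : F.IsAdapted σ ω) (hB : B.IsSimple)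
    {φ : B.PathSpace ≃ₜ B.PathSpace} (hφ : ω.IsVershikMap φ) (v : F.maxV) :
    φ (F.maxPath v) = F.minPath (σ v) := by
  have := PathSpace.t2Space B
  obtain ⟨ψ, hψ⟩ := h.exists_homeomorph
  choose x hx hxv using h.exists_notMem_maxPaths hB v
  have hlim : Filter.Tendsto x Filter.atTop (nhds (F.maxPath v)) :=
    PathSpace.tendsto_of_eventually_apply_eq fun n =>
      (Filter.eventually_ge_atTop n).mono fun i hi => hxv i n hi
  have heq : ∀ n, φ (x n) = ψ (x n) := fun n =>
    h.vershikRel_unique (.inr (hφ.stepAt (hx n))) (hψ _)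
  have h1 := (φ.continuous.tendsto _).comp hlim
  have h2 := (ψ.continuous.tendsto _).comp hlim
  rw [show φ ∘ x = ψ ∘ x from funext heq] at h1
  rw [tendsto_nhds_unique h1 h2]
  exact h.vershikRel_unique (hψ _) (.inl ⟨v, rfl, rfl⟩)

end Skeleton

end BratteliDiagram

theorem mainTheorem3 (B : BratteliDiagram) (hB : B.IsSimple)
    {V : Type*} [Fintype V] [DecidableEq V] {d : ℕ} (S : B.StrictRank V d)
    (F : BratteliDiagram.Skeleton S) (σ : F.maxV ≃ F.minV)
    (hconn : ∀ᶠ m in Filter.atTop, F.PositivelyStronglyConnected σ m)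
    (hbal : ∀ᶠ m in Filter.atTop, F.BalanceRelations σ m) :
    ∃ ω : B.EdgeOrdering, ω.IsPerfect ∧ F.IsSkeletonOf ω ∧
      ∀ φ : B.PathSpace ≃ₜ B.PathSpace, ω.IsVershikMap φ →
        ∀ v : F.maxV, φ (F.maxPath v) = F.minPath (σ v) := by
  obtain ⟨ω, hω⟩ := F.exists_isAdapted σ hconn hbal
  obtain ⟨φ, hφ⟩ := hω.exists_homeomorph
  exact ⟨ω, ⟨φ, hω.isVershikMap hφ⟩, hω.isSkeletonOf, fun ψ hψ v => hω.apply_maxPath hB hψ v⟩
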